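/- Let $I$ be a finite set and $M=(m_{ij})_{i,j\in I}$ a Coxeter matrix with $m_{ij}\in\{2,\infty\}$ for all $i\neq j$. Let $\Delta$ be a building of type $M$, viewed as a (non-empty) chamber system, that is semiregular: for each $i\in I$ all $i$-panels have the same (possibly infinite) cardinality $q_i\ge 2$. For each $i\in I$ let $X_i$ be a set with $|X_i|=q_i$, and let $\lambda=(\lambda_i)_{i\in I}\colon\Delta\to\prod_{i\in I}X_i$ be a legal colouring: for every $i$-panel $\mathcal P$, the restriction $\lambda_i|_{\mathcal P}\colon\mathcal P\to X_i$ is a bijection and $\lambda_j|_{\mathcal P}$ is constant for each $j\ne i$. For a type-preserving automorphism $g\in\operatorname{Aut}(\Delta)$ and an $i$-panel $\mathcal P$, put $\sigma_\lambda(g,\mathcal P)=\lambda_i|_{g\mathcal P}\circ g|_{\mathcal P}\circ(\lambda_i|_{\mathcal P})^{-1}\in\operatorname{Sym}(X_i)$. Given permutation groups $F_i\le\operatorname{Sym}(X_i)$ $(i\in I)$, not necessarily transitive or of finite degree, let $$U(\boldsymbol F)=\{g\in\operatorname{Aut}(\Delta)\mid \sigma_\lambda(g,\mathcal P)\in F_i\text{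 for every }i\in I\text{ and every }i\text{-panel }\mathcal P\}.$$ All permutation groups carry the permutation topology, in which the pointwise stabilisers of finite sets form a neighbourhood basis of the identity; here $U(\boldsymbol F)$ acts on the set of chambers of $\Delta$. Assume that every $F_i$ is closed in $\operatorname{Sym}(X_i)$, and consider the conditions (i) every point stabiliser in every $F_i$ is compact; (ii) every chamber stabiliser in $U(\boldsymbol F)$ is compact; (iii) $U(\boldsymbol F)$ is a locally compact topological group. If the diagram of $\Delta$ has no isolated nodes (for every $i\in I$ there is $j\in I$ with $m_{ij}=\infty$), then (i), (ii) and (iii) are equivalent. Without this assumption on the diagram, (i) and (ii) are still equivalent, and they imply (iii). -/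

import Mathlib

universe u v w

/-! ### The permutation topology -/

/-- The permutation topology on `Sym(Y)`: the topology of pointwise convergence, where `Y` is
discrete. Subgroups of `Sym(Y)` carry the subspace topology. -/
instance permTopology (Y : Type u) : TopologicalSpace (Equiv.Perm Y) :=
  TopologicalSpace.induced (fun g : Equiv.Perm Y => (g : Y → Y))
    (@Pi.topologicalSpace Y (fun _ => Y) (fun _ => ⊥))

/-- A neighbourhood basis of `g` is given by the cosets of the pointwise stabilisers of the
finite subsets of `Y`. -/
theorem permTopology_hasBasis_nhds {Y : Type u} (g : Equiv.Perm Y) :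
    (nhds g).HasBasis (fun s : Set Y => s.Finite) (fun s => {h | ∀ y ∈ s, h y = g y}) := by
  let tY : TopologicalSpace Y := ⊥
  have hd : DiscreteTopology Y := ⟨rfl⟩
  refine ⟨fun t => ?_⟩
  have h1 : nhds g = Filter.comap (fun k : Equiv.Perm Y => (k : Y → Y)) (nhds (g : Y → Y)) :=
    nhds_induced _ _
  rw [h1, Filter.mem_comap]
  constructor
  · rintro ⟨T, hT, hsub⟩
    rw [nhds_pi, Filter.mem_pi] at hT
    obtain ⟨s, hs, V, hV, hsV⟩ := hT
    refine ⟨s, hs, fun k hk => hsub (hsV fun y hy => ?_)⟩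
    change k y ∈ V y
    rw [show k y = g y from hk y hy]
    exact mem_of_mem_nhds (hV y)
  · rintro ⟨s, hs, hsub⟩
    refine ⟨s.pi fun y => {g y}, set_pi_mem_nhds hs fun y _ => by simp, fun k hk => hsub ?_⟩
    exact fun y hy => hk y hy

/-- With the permutation topology, `Sym(Y)` (hence each of its subgroups) is a topological
group. -/
instance permTopology_isTopologicalGroup (Y : Type u) :
    IsTopologicalGroup (Equiv.Perm Y) where
  continuous_mul := by
    rw [continuous_iff_continuousAt]
    rintro ⟨g, h⟩
    have hb := (permTopology_hasBasis_nhds g).prod_nhds (permTopology_hasBasis_nhds h)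
    refine (hb.tendsto_iff (permTopology_hasBasis_nhds (g * h))).2 fun s hs => ?_
    refine ⟨(h '' s, s), ⟨hs.image h, hs⟩, ?_⟩
    rintro ⟨a, b⟩ ⟨ha, hb'⟩ y hy
    change a (b y) = g (h y)
    rw [show b y = h y from hb' y hy]
    exact ha _ ⟨y, hy, rfl⟩
  continuous_inv := by
    rw [continuous_iff_continuousAt]
    intro g
    refine ((permTopology_hasBasis_nhds g).tendsto_iff
      (permTopology_hasBasis_nhds g⁻¹)).2 fun s hs => ?_
    refine ⟨(fun y => g⁻¹ y) '' s, hs.image _, ?_⟩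
    intro a ha y hy
    have h1 : a (g⁻¹ y) = y := (ha _ ⟨y, hy, rfl⟩).trans (g.apply_symm_apply y)
    exact Equiv.Perm.inv_eq_iff_eq.2 h1.symm

/-! ### Chamber systems and buildings -/

/-- A chamber system over `I` with set of chambers `C`: for every `i`, an equivalence relation
on `C`, called `i`-adjacency. -/
structure ChamberSystem (I : Type u) (C : Type v) where
  adj : I → Setoid C

namespace ChamberSystem

variable {I : Type u} {C : Type v}

/-- `Δ.IsGallery c ω d`: there is a gallery of type `ω` from `c` to `d`, that is, a sequence of
chambers in which consecutive chambers are distinct and adjacent, with adjacency types `ω`. -/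
inductive IsGallery (Δ : ChamberSystem I C) : C → List I → C → Prop
  | nil (c : C) : IsGallery Δ c [] c
  | cons {c d e : C} {i : I} {ω : List I} :
      (Δ.adj i) c d → c ≠ d → IsGallery Δ d ω e → IsGallery Δ c (i :: ω) e

/-- The `i`-panel containing the chamber `c`. -/
def panel (Δ : ChamberSystem I C) (i : I) (c : C) : Set C := {d | (Δ.adj i) c d}

/-- `Δ` is a building of type `M` (an entry `0` of a `CoxeterMatrix` stands for `∞`): it is
non-empty, every panel has at least two chambers, and there is a distance function `δ` with
values in the Coxeter group such that, for each reduced word `ω`, there is a gallery of type `ω`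
from `c` to `d` if and only if `δ c d` is the element represented by `ω`. -/
def IsBuilding (Δ : ChamberSystem I C) (M : CoxeterMatrix I) : Prop :=
  Nonempty C ∧ (∀ (i : I) (c : C), ∃ d ∈ Δ.panel i c, d ≠ c) ∧
    ∃ δ : C → C → M.Group, ∀ (c d : C) (ω : List I), M.toCoxeterSystem.IsReduced ω →
      (δ c d = M.toCoxeterSystem.wordProd ω ↔ Δ.IsGallery c ω d)

/-- `Δ` is semiregular with parameters `q_i = |X_i| ≥ 2`: all `i`-panels have the cardinality
of `X i`. -/
def IsSemiregular (Δ : ChamberSystem I C) (X : I → Type w) : Prop :=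
  ∀ i, Nontrivial (X i) ∧ ∀ c : C, Nonempty (Δ.panel i c ≃ X i)

/-- The group of type-preserving automorphisms, as a group of permutations of the chambers. -/
def Aut (Δ : ChamberSystem I C) : Subgroup (Equiv.Perm C) where
  carrier := {g | ∀ (i : I) (c d : C), (Δ.adj i) (g c) (g d) ↔ (Δ.adj i) c d}
  one_mem' := fun _ _ _ => Iff.rfl
  mul_mem' := fun {g h} hg hh i c d => (hg i (h c) (h d)).trans (hh i c d)
  inv_mem' := fun {g} hg i c d => by
    simpa using (hg i (g⁻¹ c) (g⁻¹ d)).symm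

/-- A legal colouring of `Δ` with sets of colours `X i`: for every `i`-panel, the `i`-colour
restricts to a bijection onto `X i`, and the `j`-colour is constant for `j ≠ i`. -/
structure LegalColouring (Δ : ChamberSystem I C) (X : I → Type w) where
  colour : C → (i : I) → X i
  bijective : ∀ (i : I) (c : C), Function.Bijective (fun d : Δ.panel i c => colour d.1 i)
  constant : ∀ (i j : I), j ≠ i → ∀ c : C, ∀ d ∈ Δ.panel i c, colour d j = colour c j

variable {Δ : ChamberSystem I C} {X : I → Type w}

/-- The bijection `λ_i|_P : P → X_i` for the `i`-panel `P` of `c`. -/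
noncomputable def LegalColouring.panelEquiv (lam : Δ.LegalColouring X) (i : I) (c : C) :
    Δ.panel i c ≃ X i :=
  Equiv.ofBijective _ (lam.bijective i c)

/-- The bijection `g|_P : P → gP` for the `i`-panel `P` of `c`. -/
def panelMap (g : Δ.Aut) (i : I) (c : C) : Δ.panel i c ≃ Δ.panel i (g.1 c) :=
  g.1.subtypeEquiv fun d => (g.2 i c d).symm

/-- The local action `σ(g, P) = λ_i|_{gP} ∘ g|_P ∘ (λ_i|_P)⁻¹` of `g` at the `i`-panel `P`
of `c`. -/
noncomputable def LegalColouring.localAction (lam : Δ.LegalColouring X) (g : Δ.Aut) (i : I)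
    (c : C) : Equiv.Perm (X i) :=
  (lam.panelEquiv i c).symm.trans ((panelMap g i c).trans (lam.panelEquiv i (g.1 c)))

theorem LegalColouring.localAction_colour (lam : Δ.LegalColouring X) (g : Δ.Aut) (i : I)
    (c d : C) (hd : d ∈ Δ.panel i c) :
    lam.localAction g i c (lam.colour d i) = lam.colour (g.1 d) i := by
  have h : (lam.panelEquiv i c).symm (lam.colour d i) = ⟨d, hd⟩ :=
    (lam.panelEquiv i c).symm_apply_apply ⟨d, hd⟩
  simp only [LegalColouring.localAction, Equiv.trans_apply, h]
  rfl

theorem LegalColouring.localAction_eq_of_colour (lam : Δ.LegalColouring X) (g : Δ.Aut) (i : I)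
    (c : C) (f : Equiv.Perm (X i))
    (hf : ∀ d ∈ Δ.panel i c, f (lam.colour d i) = lam.colour (g.1 d) i) :
    lam.localAction g i c = f := by
  ext x
  obtain ⟨⟨d, hd⟩, rfl⟩ := (lam.bijective i c).2 x
  exact (lam.localAction_colour g i c d hd).trans (hf d hd).symm

theorem LegalColouring.localAction_mul (lam : Δ.LegalColouring X) (g h : Δ.Aut) (i : I)
    (c : C) :
    lam.localAction (g * h) i c = lam.localAction g i (h.1 c) * lam.localAction h i c := by
  refine lam.localAction_eq_of_colour _ i c _ fun d hd => ?_
  rw [Equiv.Perm.mul_apply, lam.localAction_colour h i c d hd,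
    lam.localAction_colour g i (h.1 c) (h.1 d) ((h.2 i c d).2 hd)]
  rfl

theorem LegalColouring.localAction_one (lam : Δ.LegalColouring X) (i : I) (c : C) :
    lam.localAction (1 : Δ.Aut) i c = 1 :=
  lam.localAction_eq_of_colour _ i c _ fun _ _ => rfl

/-- The universal group `U(F)`: the automorphisms of `Δ` all of whose local actions, at all
`i`-panels for all `i`, lie in `F i`. -/
def universalGroup (lam : Δ.LegalColouring X) (F : (i : I) → Subgroup (Equiv.Perm (X i))) :
    Subgroup Δ.Aut where
  carrier := {g | ∀ (i : I) (c : C), lam.localAction g i c ∈ F i}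
  one_mem' := fun i c => by
    rw [lam.localAction_one]
    exact (F i).one_mem
  mul_mem' := fun {g h} hg hh i c => by
    rw [lam.localAction_mul]
    exact (F i).mul_mem (hg i _) (hh i c)
  inv_mem' := fun {g} hg i c => by
    have h := lam.localAction_mul g g⁻¹ i c
    rw [mul_inv_cancel, lam.localAction_one] at h
    rw [← inv_eq_of_mul_eq_one_right h.symm]
    exact (F i).inv_mem (hg i _)

end ChamberSystem

/-- The Coxeter diagram is right-angled: `m_ij ∈ {2, ∞}` for distinct `i` and `j`. -/
def CoxeterMatrix.IsRightAngled {I : Type u} (M : CoxeterMatrix I) : Prop :=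
  ∀ i j : I, i ≠ j → M i j = 2 ∨ M i j = 0

/-- The Coxeter diagram has no isolated nodes: each `i` is joined to some `j ≠ i`, that is,
`m_ij ≠ 2`. -/
def CoxeterMatrix.NoIsolatedNodes {I : Type u} (M : CoxeterMatrix I) : Prop :=
  ∀ i : I, ∃ j : I, j ≠ i ∧ M i j ≠ 2

/-! A closed subgroup of `Sym(Y)` is compact exactly when its orbits are finite
(`isCompact_subgroup_iff`), and `U(F)` is closed. So (i) and (ii) say that point stabilisers in the
`F i`, respectively chamber stabilisers in `U(F)`, have finite orbits. For (i) ⇒ (ii), induct along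
a gallery from the fixed chamber: two elements with the same image of `d` differ locally at `d` by
an element of `F i` fixing the colour of `d`. Chamber stabilisers are open, whence (ii) ⇒ (iii).

The converses require elements of `U(F)`. Two legal colourings that agree at a chamber differ by an
automorphism fixing it (`exists_aut`). Let `f ∈ F i` fix `x`, and let `V` be a set of chambers whose
boundary is crossed only by `i`-panels, each meeting `V` in its chamber of colour `x`. Applying `f`
to the `i`-colours outside `V` gives another legal colouring, and the resulting automorphism lies in
`U(F)` (`exists_universalGroup_of_perm`). Taking `V = ∅` yields (ii) ⇒ (i). For (iii) ⇒ (i), local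
compactness provides a finite set `S` of chambers whose pointwise stabiliser has finite orbits. When
`m_ij = ∞`, the building folds onto a line; a half-line pulls back to a set `V` deep enough to
contain `S`, and `f` is realised at its boundary by an element fixing `S`
(`exists_local_action_of_finite`).

`exists_aut` rests on simple connectivity (`Transport.Lift.eq_of_closed`): closed galleries contract
through panels and commuting squares. This reduces to the word problem in right-angled Coxeter
groups (`exists_of_not_isReduced`), solved through the dual geometric representation. -/

namespace CoxeterMatrix

/-! ### The word problem in right-angled Coxeter groups. -/

variable {I : Type u} {M : CoxeterMatrix I}

open Classical in
/-- The dual of the geometric action of the generator `s` of a right-angled Coxeter group, on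
integer-valued functions on the set of simple roots. -/
noncomputable def dualReflection (M : CoxeterMatrix I) (s : I) (f : I → ℤ) : I → ℤ :=
  fun t => if t = s then -f s else if M s t = 0 then f t + 2 * f s else f t

theorem dualReflection_self (s : I) (f : I → ℤ) : M.dualReflection s f s = -f s := by
  simp [dualReflection]

theorem dualReflection_of_eq_zero {s t : I} (h : M s t = 0) (f : I → ℤ) :
    M.dualReflection s f t = f t + 2 * f s := by
  have hne : t ≠ s := by
    rintro rfl
    simp at h
  simp [dualReflection, h, hne]

theorem dualReflection_of_eq_two {s t : I} (h : M s t = 2) (f : I → ℤ) :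
    M.dualReflection s f t = f t := by
  have hne : t ≠ s := by
    rintro rfl
    simp at h
  simp [dualReflection, h, hne]

/-- `dualReflection` as an element of the monoid of all self-maps. -/
noncomputable def dualReflectionEnd (M : CoxeterMatrix I) (s : I) : Function.End (I → ℤ) :=
  M.dualReflection s

theorem IsRightAngled.isLiftable_dualReflection (hM : M.IsRightAngled) :
    M.IsLiftable M.dualReflectionEnd := by
  have hsq : ∀ s (f : I → ℤ), M.dualReflection s (M.dualReflection s f) = f := by
    intro s f
    funext t
    by_cases hts : t = s
    · subst hts
      rw [dualReflection_self, dualReflection_self, neg_neg]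
    rcases hM s t (Ne.symm hts) with h | h
    · rw [dualReflection_of_eq_two h, dualReflection_of_eq_two h]
    · rw [dualReflection_of_eq_zero h, dualReflection_of_eq_zero h, dualReflection_self]
      ring
  intro s t
  by_cases hst : s = t
  · subst hst
    rw [M.diagonal, pow_one]
    exact funext (hsq s)
  rcases hM s t hst with h | h
  · have h' : M t s = 2 := by rw [M.symmetric]; exact h
    have hcomm : ∀ f : I → ℤ, M.dualReflection s (M.dualReflection t f) =
        M.dualReflection t (M.dualReflection s f) := by
      intro f
      funext r
      have hts : t ≠ s := Ne.symm hst
      simp only [dualReflection]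
      split_ifs <;> simp_all <;> ring
    rw [h, pow_two]
    funext f
    change M.dualReflection s (M.dualReflection t (M.dualReflection s (M.dualReflection t f))) = f
    rw [hcomm f, hsq, hsq]
  -- The entry `0` encodes `∞`, so there is no relation to check.
  · rw [h, pow_zero]

/-- The image of the constant function `1` under the product of the word `ω`. -/
noncomputable def dualWord (M : CoxeterMatrix I) (ω : List I) : I → ℤ :=
  ω.foldr M.dualReflection 1

/-- `dualWord` is the orbit map of the constant function `1` under the dual representation. Its
value at `s` is the height of the root `w⁻¹ α_s`, whose sign detects whether `s` is a left descent
of `w`. -/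
theorem IsRightAngled.dualWord_eq (hM : M.IsRightAngled) {ω ω' : List I}
    (h : M.toCoxeterSystem.wordProd ω = M.toCoxeterSystem.wordProd ω') :
    M.dualWord ω = M.dualWord ω' := by
  have key : ∀ ω : List I, M.dualWord ω =
      M.toCoxeterSystem.lift ⟨_, hM.isLiftable_dualReflection⟩ (M.toCoxeterSystem.wordProd ω) 1 := by
    intro ω
    induction ω with
    | nil =>
      rw [CoxeterSystem.wordProd_nil, map_one]
      rfl
    | cons s ω ih =>
      have hs := M.toCoxeterSystem.lift_apply_simple hM.isLiftable_dualReflection s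
      rw [M.toCoxeterSystem.wordProd_cons, map_mul, hs]
      change M.dualReflection s (M.dualWord ω) = _
      rw [ih]
      rfl
  rw [key, key, h]

theorem isReduced_of_cons {s : I} {ω : List I} (h : M.toCoxeterSystem.IsReduced (s :: ω)) :
    M.toCoxeterSystem.IsReduced ω := h.drop 1

theorem wordProd_cons_of_commute {s : I} {u : List I} (hu : ∀ t ∈ u, M s t = 2) (b : List I) :
    M.toCoxeterSystem.wordProd (u ++ s :: b) = M.toCoxeterSystem.wordProd (s :: (u ++ b)) := by
  induction u with
  | nil => rfl
  | cons t u ih =>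
    have h2 := M.toCoxeterSystem.simple_mul_simple_pow s t
    have hst := hu t List.mem_cons_self
    rw [hst, pow_two] at h2
    have hcomm : M.toCoxeterSystem.simple s * M.toCoxeterSystem.simple t =
        M.toCoxeterSystem.simple t * M.toCoxeterSystem.simple s := by
      rw [eq_inv_of_mul_eq_one_left h2, mul_inv_rev, CoxeterSystem.inv_simple,
        CoxeterSystem.inv_simple]
    have ih' := ih fun r hr => hu r (List.mem_cons_of_mem _ hr)
    simp only [List.cons_append, CoxeterSystem.wordProd_cons] at ih' ⊢
    rw [ih', ← mul_assoc, ← hcomm, mul_assoc]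

theorem not_isReduced_of_commute {s : I} {u : List I} (hu : ∀ t ∈ u, M s t = 2) (b : List I) :
    ¬ M.toCoxeterSystem.IsReduced (s :: (u ++ s :: b)) := by
  intro h
  have h1 : M.toCoxeterSystem.wordProd (s :: (u ++ s :: b)) =
      M.toCoxeterSystem.wordProd (u ++ b) := by
    rw [CoxeterSystem.wordProd_cons, wordProd_cons_of_commute hu, CoxeterSystem.wordProd_cons,
      CoxeterSystem.simple_mul_simple_cancel_left]
  have h2 := M.toCoxeterSystem.length_wordProd_le (u ++ b)
  rw [← h1, h.eq] at h2
  simp at h2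

/-- The second clause produces a descent `s` as a letter that can be shuffled to the front. The
first is the invariant that keeps the induction going: when `r` with `m_rs = ∞` is prepended, the
value at `s` becomes `f s + 2 * f r`, which stays positive. -/
theorem IsRightAngled.dualWord_of_isReduced (hM : M.IsRightAngled) {ω : List I}
    (hω : M.toCoxeterSystem.IsReduced ω) :
    (∀ s t, M s t = 0 → 0 < M.dualWord ω s + M.dualWord ω t) ∧
      ∀ s, M.dualWord ω s ≤ 0 → ∃ u b, ω = u ++ s :: b ∧ ∀ t ∈ u, M s t = 2 := by
  induction ω with
  | nil => simp [dualWord]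
  | cons r ω ih =>
    obtain ⟨h1, h2⟩ := ih (isReduced_of_cons hω)
    have hr : 0 < M.dualWord ω r := by
      by_contra hneg
      obtain ⟨u, b, rfl, hu⟩ := h2 r (not_lt.1 hneg)
      exact not_isReduced_of_commute hu b hω
    have hself : M.dualWord (r :: ω) r = -M.dualWord ω r := dualReflection_self _ _
    have hzero : ∀ t, M r t = 0 → M.dualWord (r :: ω) t = M.dualWord ω t + 2 * M.dualWord ω r :=
      fun t ht => dualReflection_of_eq_zero ht _
    have htwo : ∀ t, M r t = 2 → M.dualWord (r :: ω) t = M.dualWord ω t :=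
      fun t ht => dualReflection_of_eq_two ht _
    have hge : ∀ t, t ≠ r → M.dualWord ω t ≤ M.dualWord (r :: ω) t := by
      intro t ht
      rcases hM r t ht.symm with h | h
      · rw [htwo t h]
      · rw [hzero t h]
        omega
    have hpos : ∀ t, M r t = 0 → 0 < M.dualWord ω r + M.dualWord ω t := fun t ht => h1 r t ht
    constructor
    · intro s t hst
      by_cases hs : s = r
      · subst hs
        rw [hself, hzero t hst]
        have := hpos t hst
        omega
      by_cases ht : t = r
      · subst ht
        rw [M.symmetric] at hst
        rw [hself, hzero s hst]
        have := hpos s hst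
        omega
      have := h1 s t hst
      have := hge s hs
      have := hge t ht
      omega
    · intro s hs
      by_cases hsr : s = r
      · subst hsr
        exact ⟨[], ω, rfl, by simp⟩
      rcases hM r s (Ne.symm hsr) with h | h
      · rw [htwo s h] at hs
        obtain ⟨u, b, rfl, hu⟩ := h2 s hs
        refine ⟨r :: u, b, rfl, ?_⟩
        intro t ht
        rcases List.mem_cons.1 ht with rfl | ht
        · rw [M.symmetric]; exact h
        · exact hu t ht
      · rw [hzero s h] at hs
        have := hpos s h
        omega

/-- In a right-angled Coxeter group, a word that is not reduced has two equal letters which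
commute with all letters in between. -/
theorem IsRightAngled.exists_of_not_isReduced (hM : M.IsRightAngled) {ω : List I}
    (hω : ¬ M.toCoxeterSystem.IsReduced ω) :
    ∃ a s u b, ω = a ++ s :: (u ++ s :: b) ∧ ∀ t ∈ u, M s t = 2 := by
  induction ω with
  | nil => exact absurd (by simp [CoxeterSystem.IsReduced]) hω
  | cons s ω ih =>
    by_cases hred : M.toCoxeterSystem.IsReduced ω
    · have hlen : M.toCoxeterSystem.length (M.toCoxeterSystem.wordProd (s :: ω)) + 1 =
          ω.length := by
        have h := M.toCoxeterSystem.length_simple_mul (M.toCoxeterSystem.wordProd ω) s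
        rw [← CoxeterSystem.wordProd_cons, hred.eq] at h
        exact h.resolve_left hω
      -- Since `s` shortens `ω`, prepending `s` to a reduced word for the product gives another
      -- reduced word for the element of `ω`. Its first letter `s` forces a negative value at `s`.
      obtain ⟨ω', hω', heq⟩ :=
        M.toCoxeterSystem.exists_isReduced (M.toCoxeterSystem.wordProd (s :: ω))
      have hprod : M.toCoxeterSystem.wordProd (s :: ω') = M.toCoxeterSystem.wordProd ω := by
        rw [CoxeterSystem.wordProd_cons, ← heq, CoxeterSystem.wordProd_cons,
          CoxeterSystem.simple_mul_simple_cancel_left]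
      have hred' : M.toCoxeterSystem.IsReduced (s :: ω') := by
        unfold CoxeterSystem.IsReduced
        rw [hprod, hred.eq, List.length_cons, ← hω'.eq, ← heq, hlen]
      have hpos : 0 < M.dualWord ω' s := by
        by_contra hneg
        obtain ⟨u, b, rfl, hu⟩ := (hM.dualWord_of_isReduced hω').2 s (not_lt.1 hneg)
        exact not_isReduced_of_commute hu b hred'
      have hneg : M.dualWord ω s ≤ 0 := by
        rw [← hM.dualWord_eq hprod]
        change M.dualReflection s (M.dualWord ω') s ≤ 0
        rw [dualReflection_self]
        omega
      obtain ⟨u, b, rfl, hu⟩ := (hM.dualWord_of_isReduced hred).2 s hneg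
      exact ⟨[], s, u, b, rfl, hu⟩
    · obtain ⟨a, t, u, b, rfl, hu⟩ := ih hred
      exact ⟨s :: a, t, u, b, rfl, hu⟩

theorem IsRightAngled.isReduced_pair (hM : M.IsRightAngled) {s t : I} (h : s ≠ t) :
    M.toCoxeterSystem.IsReduced [s, t] := by
  by_contra hred
  obtain ⟨a, r, u, b, heq, -⟩ := hM.exists_of_not_isReduced hred
  have hlen := congrArg List.length heq
  simp only [List.length_cons, List.length_append, List.length_nil] at hlen
  obtain rfl : a = [] := List.length_eq_zero_iff.1 (by omega)
  obtain rfl : u = [] := List.length_eq_zero_iff.1 (by omega)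
  simp only [List.nil_append, List.cons.injEq] at heq
  exact h (heq.1.trans heq.2.1.symm)

end CoxeterMatrix

/-! ### Transport along galleries and simple connectivity. -/

namespace ChamberSystem

variable {I : Type u} {C : Type v} {Δ : ChamberSystem I C} {M : CoxeterMatrix I} {Y : Type w}

/-- The words `ij` and `ji` are reduced and represent the same element, so the distance function
turns a gallery of one type into one of the other. -/
theorem IsBuilding.exists_square (hΔ : Δ.IsBuilding M) (hM : M.IsRightAngled) {i j : I}
    (hij : M i j = 2) {c d e : C} (hcd : (Δ.adj i) c d) (hde : (Δ.adj j) d e) :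
    ∃ d', (Δ.adj j) c d' ∧ (Δ.adj i) d' e := by
  by_cases h1 : c = d
  · subst h1
    exact ⟨e, hde, (Δ.adj i).refl e⟩
  by_cases h2 : d = e
  · subst h2
    exact ⟨c, (Δ.adj j).refl c, hcd⟩
  have hne : i ≠ j := by
    rintro rfl
    simp at hij
  obtain ⟨-, -, δ, hδ⟩ := hΔ
  have hprod : M.toCoxeterSystem.wordProd [i, j] = M.toCoxeterSystem.wordProd [j, i] := by
    have h := CoxeterMatrix.wordProd_cons_of_commute (M := M) (s := i) (u := [j]) (by simpa) []
    exact h.symm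
  have hg := (hδ c e [i, j] (hM.isReduced_pair hne)).2 (.cons hcd h1 (.cons hde h2 (.nil e)))
  rw [hprod] at hg
  cases (hδ c e [j, i] (hM.isReduced_pair hne.symm)).1 hg with
  | cons h3 _ h4 =>
    cases h4 with
    | cons h5 _ h6 =>
      cases h6
      exact ⟨_, h3, h5⟩

/-- A rule to transport elements of `Y` (subject to a condition `good` that depends on the chamber)
along adjacent chambers, consistently on panels and on squares of commuting types. -/
structure Transport (Δ : ChamberSystem I C) (M : CoxeterMatrix I) (Y : Type w) where
  map : I → C → C → Y → Y
  good : C → Y → Prop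
  good_map : ∀ {i d e y}, (Δ.adj i) d e → good d y → good e (map i d e y)
  map_self : ∀ {i d y}, good d y → map i d d y = y
  map_map : ∀ {i d e f y}, (Δ.adj i) d e → (Δ.adj i) e f → good d y →
    map i e f (map i d e y) = map i d f y
  map_comm : ∀ {i j c d d' e y}, M i j = 2 → (Δ.adj i) c d → (Δ.adj j) d e → (Δ.adj j) c d' →
    (Δ.adj i) d' e → good c y → map j d e (map i c d y) = map i d' e (map j c d' y)

namespace Transport

/-- `T.Lift c y ω d z`: transport along some sequence of adjacent (possibly equal) chambers of
type `ω` from `c` to `d` takes `y` to `z`. -/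
inductive Lift (T : Transport Δ M Y) : C → Y → List I → C → Y → Prop
  | nil (c : C) (y : Y) : Lift T c y [] c y
  | cons {c d e : C} {y z : Y} {i : I} {ω : List I} :
      (Δ.adj i) c d → Lift T d (T.map i c d y) ω e z → Lift T c y (i :: ω) e z

variable {T : Transport Δ M Y} {c d e : C} {y z t : Y} {ω ω' : List I}

theorem Lift.good (h : T.Lift c y ω d z) (hy : T.good c y) : T.good d z := by
  induction h with
  | nil => exact hy
  | cons hadj _ ih => exact ih (T.good_map hadj hy)

theorem Lift.append (h : T.Lift c y ω d z) (h' : T.Lift d z ω' e t) :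
    T.Lift c y (ω ++ ω') e t := by
  induction h with
  | nil => exact h'
  | cons hadj _ ih => exact .cons hadj (ih h')

theorem Lift.exists_of_append {a b : List I} (h : T.Lift c y (a ++ b) d z) :
    ∃ e t, T.Lift c y a e t ∧ T.Lift e t b d z := by
  induction a generalizing c y with
  | nil => exact ⟨c, y, .nil c y, h⟩
  | cons i a ih =>
    cases h with
    | cons hadj h =>
      obtain ⟨e, t, h1, h2⟩ := ih h
      exact ⟨e, t, .cons hadj h1, h2⟩

theorem Lift.reverse (h : T.Lift c y ω d z) (hy : T.good c y) : T.Lift d z ω.reverse c y := by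
  induction h with
  | nil => exact .nil _ _
  | @cons c d e y z i ω hadj _ ih =>
    rw [List.reverse_cons]
    refine (ih (T.good_map hadj hy)).append (.cons ((Δ.adj i).symm hadj) ?_)
    rw [T.map_map hadj ((Δ.adj i).symm hadj) hy, T.map_self hy]
    exact .nil _ _

/-- Merging two steps can create a stationary step. Such a step transports trivially and can be
dropped. -/
theorem Lift.isGallery_or_shorten (h : T.Lift c y ω d z) (hy : T.good c y) :
    Δ.IsGallery c ω d ∨ ∃ ω', ω'.length < ω.length ∧ T.Lift c y ω' d z := by
  induction h with
  | nil c => exact .inl (.nil c)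
  | @cons c d e y z i ω hadj h ih =>
    by_cases hcd : c = d
    · subst hcd
      rw [T.map_self hy] at h
      exact .inr ⟨ω, by simp, h⟩
    rcases ih (T.good_map hadj hy) with hg | ⟨ω', hlt, h'⟩
    · exact .inl (.cons hadj hcd hg)
    · exact .inr ⟨i :: ω', by simpa using hlt, .cons hadj h'⟩

theorem Lift.commute (hM : M.IsRightAngled) (hΔ : Δ.IsBuilding M) {s : I} {u b : List I}
    (hu : ∀ t ∈ u, M s t = 2) (h : T.Lift c y (s :: (u ++ b)) d z) (hy : T.good c y) :
    T.Lift c y (u ++ s :: b) d z := by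
  induction u generalizing c y with
  | nil => exact h
  | cons r u ih =>
    cases h with
    | cons h1 h =>
      cases h with
      | cons h2 h =>
        have hr := hu r List.mem_cons_self
        obtain ⟨d', h3, h4⟩ := hΔ.exists_square hM hr h1 h2
        rw [T.map_comm hr h1 h2 h3 h4 hy] at h
        exact .cons h3 (ih (fun t ht => hu t (List.mem_cons_of_mem _ ht)) (.cons h4 h)
          (T.good_map h3 hy))

theorem Lift.merge {s : I} {b : List I} (h : T.Lift c y (s :: s :: b) d z) (hy : T.good c y) :
    T.Lift c y (s :: b) d z := by
  cases h with
  | cons h1 h =>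
    cases h with
    | cons h2 h =>
      rw [T.map_map h1 h2 hy] at h
      exact .cons ((Δ.adj s).trans h1 h2) h

/-- Transport along closed galleries is trivial: right-angled buildings are simply connected. -/
theorem Lift.eq_of_closed (hM : M.IsRightAngled) (hΔ : Δ.IsBuilding M)
    (h : T.Lift c y ω c z) (hy : T.good c y) : z = y := by
  induction hn : ω.length using Nat.strong_induction_on generalizing ω with
  | _ n ih =>
    subst hn
    rcases h.isGallery_or_shorten hy with hg | ⟨ω', hlt, h'⟩
    · by_cases hred : M.toCoxeterSystem.IsReduced ω
      -- A closed gallery of reduced type represents `δ c c = 1`, so its type is empty.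
      · obtain ⟨-, -, δ, hδ⟩ := hΔ
        have h1 := (hδ c c ω hred).2 hg
        have h2 := (hδ c c [] (by simp [CoxeterSystem.IsReduced])).2 (.nil c)
        rw [h2, CoxeterSystem.wordProd_nil] at h1
        have h3 := hred.eq
        rw [← h1, CoxeterSystem.length_one] at h3
        obtain rfl := List.length_eq_zero_iff.1 h3.symm
        cases h
        rfl
      -- Commuting squares bring the two letters `s` together; merging them inside one panel
      -- shortens the type by one.
      · obtain ⟨a, s, u, b, rfl, hu⟩ := hM.exists_of_not_isReduced hred
        obtain ⟨e, t, h1, h2⟩ := h.exists_of_append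
        have ht := h1.good hy
        have h3 := h2.commute hM hΔ hu ht
        obtain ⟨f, r, h4, h5⟩ := h3.exists_of_append
        exact ih _ (by simp) (h1.append (h4.append (h5.merge (h4.good ht)))) rfl
    · exact ih _ hlt h' rfl

theorem exists_lift_of_isGallery (T : Transport Δ M Y) (h : Δ.IsGallery c ω d) (y : Y) :
    ∃ z, T.Lift c y ω d z := by
  induction h generalizing y with
  | nil c => exact ⟨y, .nil c y⟩
  | cons hadj _ _ ih =>
    obtain ⟨z, hz⟩ := ih (T.map _ _ _ y)
    exact ⟨z, .cons hadj hz⟩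

end Transport

theorem IsBuilding.exists_isGallery (hΔ : Δ.IsBuilding M) (c d : C) : ∃ ω, Δ.IsGallery c ω d := by
  obtain ⟨-, -, δ, hδ⟩ := hΔ
  obtain ⟨ω, hω, heq⟩ := M.toCoxeterSystem.exists_isReduced (δ c d)
  exact ⟨ω, (hδ c d ω hω).1 heq⟩

theorem IsBuilding.induction_on (hΔ : Δ.IsBuilding M) {p : C → Prop} (c : C) (hc : p c)
    (hp : ∀ i d e, (Δ.adj i) d e → p d → p e) (d : C) : p d := by
  obtain ⟨ω, hω⟩ := hΔ.exists_isGallery c d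
  induction hω with
  | nil => exact hc
  | cons hadj _ _ ih => exact ih (hp _ _ _ hadj hc)

/-- By simple connectivity, transport does not depend on the gallery, so a local rule integrates to
a global map. -/
theorem Transport.exists_section (T : Transport Δ M Y) (hM : M.IsRightAngled)
    (hΔ : Δ.IsBuilding M) (c : C) (y : Y) (hy : T.good c y) :
    ∃ Φ : C → Y, Φ c = y ∧ (∀ d, T.good d (Φ d)) ∧
      ∀ i d e, (Δ.adj i) d e → Φ e = T.map i d e (Φ d) := by
  have hex : ∀ d, ∃ z ω, T.Lift c y ω d z := fun d => by
    obtain ⟨ω, hω⟩ := hΔ.exists_isGallery c d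
    obtain ⟨z, hz⟩ := T.exists_lift_of_isGallery hω y
    exact ⟨z, ω, hz⟩
  have huniq : ∀ {d z z' ω ω'}, T.Lift c y ω d z → T.Lift c y ω' d z' → z = z' := by
    intro d z z' ω ω' h h'
    exact (((h.reverse hy).append h').eq_of_closed hM hΔ (h.good hy)).symm
  choose Φ hΦ using hex
  refine ⟨Φ, ?_, ?_, ?_⟩
  · obtain ⟨ω, h⟩ := hΦ c
    exact huniq h (.nil c y)
  · intro d
    obtain ⟨ω, h⟩ := hΦ d
    exact h.good hy
  · intro i d e hde
    obtain ⟨ω, h⟩ := hΦ d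
    obtain ⟨ω', h'⟩ := hΦ e
    exact huniq h' (h.append (.cons hde (.nil _ _)))

end ChamberSystem

/-! ### Legal colourings and the construction of automorphisms. -/

namespace ChamberSystem

variable {I : Type u} {C : Type v} {X : I → Type w} {Δ : ChamberSystem I C} {M : CoxeterMatrix I}

namespace LegalColouring

theorem colour_eq (lam : Δ.LegalColouring X) {i j : I} {c d : C} (h : (Δ.adj i) c d)
    (hij : j ≠ i) : lam.colour d j = lam.colour c j :=
  lam.constant i j hij c d h

theorem eq_of_colour_eq (lam : Δ.LegalColouring X) {i : I} {c d : C} (h : (Δ.adj i) c d)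
    (hcol : lam.colour c i = lam.colour d i) : c = d := by
  have := (lam.bijective i c).1 (a₁ := ⟨c, (Δ.adj i).refl c⟩) (a₂ := ⟨d, h⟩) hcol
  exact congrArg Subtype.val this

/-- The chamber of `i`-colour `x` in the `i`-panel of `c`. -/
noncomputable def move (lam : Δ.LegalColouring X) (i : I) (x : X i) (c : C) : C :=
  ((lam.bijective i c).2 x).choose.1

theorem adj_move (lam : Δ.LegalColouring X) (i : I) (x : X i) (c : C) :
    (Δ.adj i) c (lam.move i x c) :=
  ((lam.bijective i c).2 x).choose.2

theorem colour_move (lam : Δ.LegalColouring X) (i : I) (x : X i) (c : C) :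
    lam.colour (lam.move i x c) i = x :=
  ((lam.bijective i c).2 x).choose_spec

theorem eq_move (lam : Δ.LegalColouring X) {i : I} {x : X i} {c d : C} (h : (Δ.adj i) c d)
    (hd : lam.colour d i = x) : d = lam.move i x c :=
  lam.eq_of_colour_eq ((Δ.adj i).trans ((Δ.adj i).symm h) (lam.adj_move i x c))
    (hd.trans (lam.colour_move i x c).symm)

theorem move_comm (lam : Δ.LegalColouring X) (hM : M.IsRightAngled) (hΔ : Δ.IsBuilding M)
    {i j : I} (hij : M i j = 2) (x : X i) (y : X j) (c : C) :
    lam.move j y (lam.move i x c) = lam.move i x (lam.move j y c) := by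
  have hne : i ≠ j := by
    rintro rfl
    simp at hij
  have h1 := lam.adj_move i x c
  have h2 := lam.adj_move j y (lam.move i x c)
  obtain ⟨d, h3, h4⟩ := hΔ.exists_square hM hij h1 h2
  have hd : d = lam.move j y c := lam.eq_move h3 <| by
    rw [← lam.colour_eq h4 hne.symm, lam.colour_move]
  subst hd
  exact lam.eq_move h4 (by rw [lam.colour_eq h2 hne, lam.colour_move])

/-- Transport of chambers for a pair of legal colourings: copy every step of a gallery, with its
type and its colour. -/
noncomputable def copyTransport (hM : M.IsRightAngled) (hΔ : Δ.IsBuilding M)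
    (lam lam' : Δ.LegalColouring X) : Transport Δ M C where
  map i _ e y := lam.move i (lam'.colour e i) y
  good d y := ∀ i, lam.colour y i = lam'.colour d i
  good_map := by
    intro i d e y hde hy j
    by_cases hij : j = i
    · subst hij
      exact lam.colour_move _ _ _
    · rw [lam.colour_eq (lam.adj_move _ _ _) hij, hy, lam'.colour_eq hde hij]
  map_self := fun {i d y} hy => (lam.eq_move ((Δ.adj i).refl y) (hy i)).symm
  map_map := fun {i d e f y} _ _ _ =>
    lam.eq_move ((Δ.adj i).trans (lam.adj_move _ _ _) (lam.adj_move _ _ _)) (lam.colour_move _ _ _)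
  map_comm := by
    intro i j c d d' e y hij _ hde _ hde' _
    have hne : i ≠ j := by
      rintro rfl
      simp at hij
    rw [lam.move_comm hM hΔ hij, lam'.colour_eq hde hne, lam'.colour_eq hde' hne.symm]

/-- Legal colourings of a right-angled building are unique up to automorphism. -/
theorem exists_aut (hM : M.IsRightAngled) (hΔ : Δ.IsBuilding M) (lam lam' : Δ.LegalColouring X)
    (c : C) (hc : ∀ i, lam.colour c i = lam'.colour c i) :
    ∃ g : Δ.Aut, g.1 c = c ∧ ∀ d i, lam.colour (g.1 d) i = lam'.colour d i := by
  obtain ⟨Φ, hΦc, hΦ, hΦmap⟩ := (copyTransport hM hΔ lam lam').exists_section hM hΔ c c hc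
  obtain ⟨Ψ, hΨc, hΨ, hΨmap⟩ :=
    (copyTransport hM hΔ lam' lam).exists_section hM hΔ c c fun i => (hc i).symm
  -- The composite preserves adjacency and colours and fixes `c`, so it fixes every chamber, by
  -- induction along galleries.
  have key : ∀ (l l' : Δ.LegalColouring X) (A B : C → C), A c = c → B c = c →
      (∀ d i, l.colour (A d) i = l'.colour d i) → (∀ d i, l'.colour (B d) i = l.colour d i) →
      (∀ i d e, (Δ.adj i) d e → (Δ.adj i) (A d) (A e)) →
      (∀ i d e, (Δ.adj i) d e → (Δ.adj i) (B d) (B e)) → ∀ d, B (A d) = d := by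
    intro l l' A B hA hB hcA hcB haA haB d
    refine hΔ.induction_on (p := fun d => B (A d) = d) c (by rw [hA, hB]) ?_ d
    intro i d e hde hd
    have h := haB i _ _ (haA i _ _ hde)
    rw [hd] at h
    exact l'.eq_of_colour_eq ((Δ.adj i).trans ((Δ.adj i).symm h) hde) (by rw [hcB, hcA])
  have hΦadj : ∀ i d e, (Δ.adj i) d e → (Δ.adj i) (Φ d) (Φ e) := fun i d e h => by
    rw [hΦmap i d e h]
    exact lam.adj_move _ _ _
  have hΨadj : ∀ i d e, (Δ.adj i) d e → (Δ.adj i) (Ψ d) (Ψ e) := fun i d e h => by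
    rw [hΨmap i d e h]
    exact lam'.adj_move _ _ _
  have h1 := key lam lam' Φ Ψ hΦc hΨc hΦ hΨ hΦadj hΨadj
  have h2 := key lam' lam Ψ Φ hΨc hΦc hΨ hΦ hΨadj hΦadj
  refine ⟨⟨⟨Φ, Ψ, h1, h2⟩, fun i d e => ⟨fun h => ?_, hΦadj i d e⟩⟩, hΦc, hΦ⟩
  have h3 := hΨadj i _ _ h
  change (Δ.adj i) (Ψ (Φ d)) (Ψ (Φ e)) at h3
  rwa [h1, h1] at h3

open Classical in
/-- Replace the `i`-colours of the chambers outside `V` by their images under `f`. -/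
noncomputable def twist (lam : Δ.LegalColouring X) {i : I} {x : X i} (f : Equiv.Perm (X i))
    (hf : f x = x) (V : Set C) (hV : ∀ k d e, k ≠ i → (Δ.adj k) d e → d ∈ V → e ∈ V)
    (hVi : ∀ d e, (Δ.adj i) d e → d ∈ V → e ∉ V → lam.colour d i = x) :
    Δ.LegalColouring X where
  colour d := Function.update (lam.colour d) i
    (if d ∈ V then lam.colour d i else f (lam.colour d i))
  bijective := by
    intro k c
    by_cases hk : k = i
    · subst hk
      simp only [Function.update_self]
      have hadj : ∀ d e : Δ.panel k c, (Δ.adj k) d.1 e.1 := fun d e =>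
        (Δ.adj k).trans ((Δ.adj k).symm d.2) e.2
      -- A panel meeting both `V` and its complement meets `V` only in the chamber of colour `x`,
      -- which `f` fixes. The new colour is therefore the old one followed by `f` on the whole
      -- panel.
      have hmixed : ∀ d e : Δ.panel k c, d.1 ∈ V → e.1 ∉ V →
          lam.colour d.1 k = f (lam.colour e.1 k) → lam.colour d.1 k = lam.colour e.1 k := by
        intro d e hd he h
        have hx := hVi d.1 e.1 (hadj d e) hd he
        rw [hx] at h ⊢
        exact f.injective (hf.trans h)
      constructor
      · intro d e h
        apply (lam.bijective k c).1
        dsimp only at h ⊢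
        split_ifs at h with hd he he
        · exact h
        · exact hmixed d e hd he h
        · exact (hmixed e d he hd h.symm).symm
        · exact f.injective h
      · intro z
        obtain ⟨d, hd⟩ := (lam.bijective k c).2 z
        obtain ⟨e, he⟩ := (lam.bijective k c).2 (f.symm z)
        dsimp only at hd he
        by_cases hdV : d.1 ∈ V
        · exact ⟨d, by simp [hdV, hd]⟩
        by_cases heV : e.1 ∈ V
        · have h := hVi e.1 d.1 (hadj e d) heV hdV
          refine ⟨e, ?_⟩
          simp only [heV, if_true]
          rw [h, ← f.apply_symm_apply z, ← he, h, hf]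
        · exact ⟨e, by simp [heV, he]⟩
    · simpa only [Function.update_of_ne hk] using lam.bijective k c
  constant := by
    intro k j hjk c d hd
    by_cases hj : j = i
    · subst hj
      simp only [Function.update_self]
      have hiff : d ∈ V ↔ c ∈ V :=
        ⟨hV k d c (Ne.symm hjk) ((Δ.adj k).symm hd), hV k c d (Ne.symm hjk) hd⟩
      simp only [hiff, lam.constant k j hjk c d hd]
    · simpa only [Function.update_of_ne hj] using lam.constant k j hjk c d hd

open Classical in
/-- An element `f` of a point stabiliser in `F i` is realised as the local action outside a
set `V` of chambers with suitable boundary by an element of the universal group that acts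
trivially on the colours in `V`. -/
theorem exists_universalGroup_of_perm (hM : M.IsRightAngled) (hΔ : Δ.IsBuilding M)
    (lam : Δ.LegalColouring X) (F : (i : I) → Subgroup (Equiv.Perm (X i))) {i : I} {x : X i}
    {f : Equiv.Perm (X i)} (hfF : f ∈ F i) (hf : f x = x) (V : Set C)
    (hV : ∀ k d e, k ≠ i → (Δ.adj k) d e → d ∈ V → e ∈ V)
    (hVi : ∀ d e, (Δ.adj i) d e → d ∈ V → e ∉ V → lam.colour d i = x)
    (a : C) (ha : a ∈ V ∨ lam.colour a i = x) :
    ∃ g ∈ universalGroup lam F, g.1 a = a ∧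
      (∀ d k, k ≠ i → lam.colour (g.1 d) k = lam.colour d k) ∧
      ∀ d, lam.colour (g.1 d) i = if d ∈ V then lam.colour d i else f (lam.colour d i) := by
  obtain ⟨g, hga, hg⟩ := exists_aut hM hΔ lam (lam.twist f hf V hV hVi) a <| by
    intro k
    by_cases hk : k = i
    · subst hk
      simp only [twist, Function.update_self]
      split_ifs with haV
      · rfl
      · rw [ha.resolve_left haV, hf]
    · simp only [twist, Function.update_of_ne hk]
  have hgk : ∀ d k, k ≠ i → lam.colour (g.1 d) k = lam.colour d k := fun d k hk => by
    rw [hg]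
    simp only [twist, Function.update_of_ne hk]
  have hgi : ∀ d, lam.colour (g.1 d) i =
      if d ∈ V then lam.colour d i else f (lam.colour d i) := fun d => by
    rw [hg]
    simp only [twist, Function.update_self]
  refine ⟨g, fun k c => ?_, hga, hgk, hgi⟩
  by_cases hk : k = i
  · subst hk
    -- The local action is `f` on an `i`-panel not contained in `V`, and trivial on all other
    -- panels.
    by_cases hex : ∃ d ∈ Δ.panel k c, d ∉ V
    · obtain ⟨d, hd, hdV⟩ := hex
      rw [lam.localAction_eq_of_colour g k c f]
      · exact hfF
      intro e he
      rw [hgi]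
      split_ifs with heV
      · rw [hVi e d ((Δ.adj k).trans ((Δ.adj k).symm he) hd) heV hdV, hf]
      · rfl
    · push Not at hex
      rw [lam.localAction_eq_of_colour g k c 1]
      · exact (F k).one_mem
      intro e he
      rw [hgi, if_pos (hex e he)]
      rfl
  · rw [lam.localAction_eq_of_colour g k c 1]
    · exact (F k).one_mem
    exact fun d _ => (hgk d k hk).symm

/-- An automorphism that fixes a chamber fixes every adjacent chamber whose colour it preserves. -/
theorem fixed_of_adj (lam : Δ.LegalColouring X) (g : Δ.Aut) {k : I} {d e : C}
    (hde : (Δ.adj k) d e) (hd : g.1 d = d) (he : lam.colour (g.1 e) k = lam.colour e k) :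
    g.1 e = e := by
  have h := (g.2 k d e).2 hde
  rw [hd] at h
  exact lam.eq_of_colour_eq ((Δ.adj k).trans ((Δ.adj k).symm h) hde) he

end LegalColouring

end ChamberSystem

/-! ### Folding onto a line, and elements fixing a finite set of chambers. -/

namespace ChamberSystem

variable {I : Type u} {C : Type v} {X : I → Type w} {Δ : ChamberSystem I C} {M : CoxeterMatrix I}

namespace LegalColouring

open Classical in
/-- Transport of integers: panels of type `i` fold onto edges `{2k, 2k + 1}`, and panels of type
`j` fold onto edges `{2k - 1, 2k}`, according to whether the colour is `x`, respectively `y`. -/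
noncomputable def foldTransport (lam : Δ.LegalColouring X) {i j : I} (hij : M i j = 0) (x : X i)
    (y : X j) : Transport Δ M ℤ where
  map k d e n :=
    if k = i then
      if (lam.colour d i = x ↔ lam.colour e i = x) then n
      else if n % 2 = 0 then n + 1 else n - 1
    else if k = j then
      if (lam.colour d j = y ↔ lam.colour e j = y) then n
      else if n % 2 = 0 then n - 1 else n + 1
    else n
  -- The residues 0, 1, 2, 3 stand for the colour pairs `(x, y)`, `(≠ x, y)`, `(≠ x, ≠ y)`, `(x, ≠
  -- y)`. Each edge of the line toggles exactly one of the two conditions.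
  good d n := (lam.colour d i = x ↔ n % 4 = 0 ∨ n % 4 = 3) ∧
    (lam.colour d j = y ↔ n % 4 = 0 ∨ n % 4 = 1)
  good_map := by
    intro k d e n hde ⟨h1, h2⟩
    have hne : i ≠ j := by
      rintro rfl
      simp at hij
    have hi : k ≠ i → lam.colour e i = lam.colour d i := fun h => lam.colour_eq hde h.symm
    have hj : k ≠ j → lam.colour e j = lam.colour d j := fun h => lam.colour_eq hde h.symm
    by_cases hki : k = i
    · rw [hj (hki ▸ hne), if_pos hki]
      split_ifs with h3 h4
      · exact ⟨h3.symm.trans h1, h2⟩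
      · by_cases hd : lam.colour d i = x <;> by_cases he : lam.colour e i = x <;>
          simp only [hd, he, true_iff, false_iff, not_or, iff_true, iff_false] at h1 h3 ⊢ <;>
          first
            | exact absurd trivial h3
            | (refine ⟨by omega, ?_⟩; rw [h2]; omega)
      · by_cases hd : lam.colour d i = x <;> by_cases he : lam.colour e i = x <;>
          simp only [hd, he, true_iff, false_iff, not_or, iff_true, iff_false] at h1 h3 ⊢ <;>
          first
            | exact absurd trivial h3
            | (refine ⟨by omega, ?_⟩; rw [h2]; omega)
    · rw [hi hki, if_neg hki]
      split_ifs with hkj h3 h4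
      · exact ⟨h1, h3.symm.trans h2⟩
      · by_cases hd : lam.colour d j = y <;> by_cases he : lam.colour e j = y <;>
          simp only [hd, he, true_iff, false_iff, not_or, iff_true, iff_false] at h2 h3 ⊢ <;>
          first
            | exact absurd trivial h3
            | (refine ⟨?_, by omega⟩; rw [h1]; omega)
      · by_cases hd : lam.colour d j = y <;> by_cases he : lam.colour e j = y <;>
          simp only [hd, he, true_iff, false_iff, not_or, iff_true, iff_false] at h2 h3 ⊢ <;>
          first
            | exact absurd trivial h3
            | (refine ⟨?_, by omega⟩; rw [h1]; omega)
      · rw [hj hkj]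
        exact ⟨h1, h2⟩
  map_self := by
    intro k d n _
    simp
  map_map := by
    intro k d e f n _ _ _
    by_cases hki : k = i
    · simp only [hki, if_true]
      by_cases h1 : lam.colour d i = x <;> by_cases h2 : lam.colour e i = x <;>
        by_cases h3 : lam.colour f i = x <;> simp only [h1, h2, h3, iff_true, if_true,
          iff_false, not_true, if_false] <;> split_ifs <;> omega
    · by_cases hkj : k = j
      · simp only [hkj, if_true]
        have hji : j ≠ i := fun h => hki (hkj.trans h)
        simp only [hji, if_false]
        by_cases h1 : lam.colour d j = y <;> by_cases h2 : lam.colour e j = y <;>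
          by_cases h3 : lam.colour f j = y <;> simp only [h1, h2, h3, iff_true, if_true,
            iff_false, not_true, if_false] <;> split_ifs <;> omega
      · simp only [hki, hkj, if_false]
  -- As `m_ij = ∞`, two types `k`, `l` with `m_kl = 2` are not both in `{i, j}`. At most one of the
  -- steps moves the integer, and the other preserves the colours that govern it.
  map_comm := by
    intro k l c d d' e n hkl hcd hde hcd' hde' _
    have hlk : l ≠ k := by
      rintro rfl
      simp at hkl
    have hij' : M j i = 0 := by rw [M.symmetric]; exact hij
    have h1 := lam.colour_eq hcd hlk
    have h2 := lam.colour_eq hde' hlk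
    have h3 := lam.colour_eq hde hlk.symm
    have h4 := lam.colour_eq hcd' hlk.symm
    by_cases hki : k = i
    · subst hki
      have hlj : l ≠ j := by
        rintro rfl
        omega
      simp only [hlk, hlj, if_true, if_false, h3, h4]
    by_cases hkj : k = j
    · subst hkj
      have hli : l ≠ i := by
        rintro rfl
        omega
      simp only [hlk, hli, hki, if_true, if_false, h3, h4]
    by_cases hli : l = i
    · subst hli
      simp only [hki, hkj, if_true, if_false, h1, h2]
    by_cases hlj : l = j
    · subst hlj
      simp only [hki, hkj, hli, if_true, if_false, h1, h2]
    simp only [hki, hkj, hli, hlj, if_false]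

/-- A folding of a right-angled building onto a line, for types `i` and `j` with `m_ij = ∞`. -/
theorem exists_fold (lam : Δ.LegalColouring X) (hM : M.IsRightAngled) (hΔ : Δ.IsBuilding M)
    {i j : I} (hij : M i j = 0) (x : X i) (y : X j) (a : C) (hax : lam.colour a i = x)
    (hay : lam.colour a j = y) :
    ∃ Φ : C → ℤ, Φ a = 0 ∧
      (∀ d, (lam.colour d i = x ↔ Φ d % 4 = 0 ∨ Φ d % 4 = 3) ∧
        (lam.colour d j = y ↔ Φ d % 4 = 0 ∨ Φ d % 4 = 1)) ∧
      (∀ k d e, (Δ.adj k) d e → Φ e ≤ Φ d + 1) ∧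
      (∀ d e, (Δ.adj i) d e → Φ d / 2 = Φ e / 2) ∧
      ∀ k d e, k ≠ i → (Δ.adj k) d e → (Φ d + 1) / 2 = (Φ e + 1) / 2 := by
  obtain ⟨Φ, h0, hgood, hmap⟩ :=
    (lam.foldTransport hij x y).exists_section hM hΔ a 0 ⟨by simpa using hax, by simpa using hay⟩
  refine ⟨Φ, h0, hgood, fun k d e h => ?_, fun d e h => ?_, fun k d e hk h => ?_⟩
  · rw [hmap k d e h]
    simp only [foldTransport]
    split_ifs <;> omega
  · rw [hmap i d e h]
    simp only [foldTransport]
    split_ifs <;> omega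
  · rw [hmap k d e h]
    simp only [foldTransport, if_neg hk]
    split_ifs <;> omega

/-- If `m_ij = ∞`, all elements of a point stabiliser in `F i` are local actions, at one suitable
panel, of elements of the universal group that fix a given finite set of chambers. -/
theorem exists_local_action_of_finite (hM : M.IsRightAngled) (hΔ : Δ.IsBuilding M)
    (hq : Δ.IsSemiregular X) (lam : Δ.LegalColouring X)
    (F : (i : I) → Subgroup (Equiv.Perm (X i))) {i j : I} (hij : M i j = 0) (x : X i)
    (S : Set C) (hS : S.Finite) :
    ∃ c : C, ∀ f ∈ F i, f x = x → ∃ g ∈ universalGroup lam F,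
      (∀ s ∈ S, g.1 s = s) ∧
      ∀ d ∈ Δ.panel i c, lam.colour (g.1 d) i = f (lam.colour d i) := by
  have hne : i ≠ j := by
    rintro rfl
    simp at hij
  obtain ⟨a₀⟩ := hΔ.1
  obtain ⟨y⟩ := (hq j).1.to_nonempty
  obtain ⟨a, hax, hay⟩ : ∃ a, lam.colour a i = x ∧ lam.colour a j = y :=
    ⟨lam.move j y (lam.move i x a₀), by
      rw [lam.colour_eq (lam.adj_move j y _) hne, lam.colour_move], lam.colour_move _ _ _⟩
  obtain ⟨x', hx'⟩ := haveI := (hq i).1; exists_ne x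
  obtain ⟨y', hy'⟩ := haveI := (hq j).1; exists_ne y
  obtain ⟨Φ, hΦa, hcol, hstep, hΦi, hΦk⟩ := lam.exists_fold hM hΔ hij x y a hax hay
  choose ω hω using fun s => hΔ.exists_isGallery a s
  obtain ⟨N, hN⟩ := (hS.image fun s => (ω s).length).bddAbove
  have hN : ∀ s ∈ S, (ω s).length ≤ N := fun s hs => hN ⟨s, hs, rfl⟩
  -- Climb by `i`-moves from even levels and `j`-moves from odd ones. Toggling the colour condition
  -- forces `Φ` to the other end of its edge.
  have hlevel : ∀ n : ℕ, ∃ d, Φ d = n := by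
    intro n
    induction n with
    | zero => exact ⟨a, by simpa using hΦa⟩
    | succ n ih =>
      obtain ⟨d, hd⟩ := ih
      push_cast
      have hd1 := (hcol d).1
      have hd2 := (hcol d).2
      rw [hd] at hd1 hd2
      have hmove : ∀ z, (lam.colour d i = x ↔ ¬ z = x) → (n : ℤ) % 2 = 0 →
          Φ (lam.move i z d) = n + 1 := by
        intro z hz hn
        have h1 := hΦi _ _ (lam.adj_move i z d)
        have h2 := (hcol (lam.move i z d)).1
        rw [lam.colour_move] at h2
        rw [hd] at h1
        have h3 : ¬ (lam.colour d i = x ↔ z = x) := by tauto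
        rw [hd1, h2] at h3
        omega
      have hmove' : ∀ z, (lam.colour d j = y ↔ ¬ z = y) → (n : ℤ) % 2 = 1 →
          Φ (lam.move j z d) = n + 1 := by
        intro z hz hn
        have h1 := hΦk j _ _ hne.symm (lam.adj_move j z d)
        have h2 := (hcol (lam.move j z d)).2
        rw [lam.colour_move] at h2
        rw [hd] at h1
        have h3 : ¬ (lam.colour d j = y ↔ z = y) := by tauto
        rw [hd2, h2] at h3
        omega
      rcases Int.emod_two_eq_zero_or_one n with hn | hn
      · by_cases h : lam.colour d i = x
        · exact ⟨_, hmove x' (by simp [h, hx']) hn⟩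
        · exact ⟨_, hmove x (by simp [h]) hn⟩
      · by_cases h : lam.colour d j = y
        · exact ⟨_, hmove' y' (by simp [h, hy']) hn⟩
        · exact ⟨_, hmove' y (by simp [h]) hn⟩
  -- A level divisible by 4 carries the `i`-colour `x`, and the edge leaving it upwards has type
  -- `i`, so `{Φ ≤ 4N}` is an admissible `V`. It contains all galleries of length at most `N` from
  -- `a`, because `Φ` grows by at most 1 per step.
  obtain ⟨c, hc⟩ := hlevel (4 * N)
  push_cast at hc
  refine ⟨c, fun f hfF hf => ?_⟩
  obtain ⟨g, hgU, hga, hgk, hgi⟩ := exists_universalGroup_of_perm hM hΔ lam F hfF hf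
    {d | Φ d ≤ 4 * N}
    (by
      intro k d e hk h hd
      have := hΦk k d e hk h
      simp only [Set.mem_ofPred_eq] at hd ⊢
      omega)
    (by
      intro d e h hd he
      have := hΦi d e h
      simp only [Set.mem_ofPred_eq] at hd he
      exact (hcol d).1.2 (by omega))
    a (.inr hax)
  -- Inside `V` all colours are preserved, so being fixed spreads from `a` along galleries that stay
  -- in `V`.
  have hfix : ∀ k d e, (Δ.adj k) d e → g.1 d = d → Φ e ≤ 4 * N → g.1 e = e := by
    intro k d e hde hd he
    refine lam.fixed_of_adj g hde hd ?_
    by_cases hk : k = i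
    · subst hk
      exact (hgi e).trans (if_pos he)
    · exact hgk e k hk
  have hgal : ∀ {d ω e}, Δ.IsGallery d ω e → g.1 d = d → Φ d + ω.length ≤ 4 * N → g.1 e = e := by
    intro d ω e h
    induction h with
    | nil => exact fun h _ => h
    | @cons d d' e k ω hadj _ _ ih =>
      intro hd hlen
      have h1 := hstep k d d' hadj
      rw [List.length_cons] at hlen
      push_cast at hlen
      exact ih (hfix k d d' hadj hd (by omega)) (by omega)
  refine ⟨g, hgU, fun s hs => hgal (hω s) hga ?_, fun d hd => ?_⟩
  · have := hN s hs
    omega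
  · rw [hgi]
    split_ifs with hdV
    · have h1 := hΦi c d hd
      have h2 : lam.colour d i = x := by
        refine (hcol d).1.2 ?_
        simp only [Set.mem_ofPred_eq] at hdV
        omega
      rw [h2, hf]
    · rfl

end LegalColouring

end ChamberSystem

/-! ### Compactness in the permutation topology. -/

section PermutationTopology

variable {Y : Type u}

theorem continuous_perm_coe (tY : TopologicalSpace Y) [DiscreteTopology Y] :
    Continuous fun g : Equiv.Perm Y => (g : Y → Y) := by
  obtain rfl : tY = ⊥ := DiscreteTopology.eq_bot
  exact continuous_induced_dom

theorem continuous_perm_apply (tY : TopologicalSpace Y) [DiscreteTopology Y] (y : Y) :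
    Continuous fun g : Equiv.Perm Y => g y :=
  (continuous_apply y).comp (continuous_perm_coe tY)

/-- `Sym(Y)` embeds as a closed subspace of `(Y → Y) × (Y → Y)` by `g ↦ (g, g⁻¹)`. -/
theorem isClosedEmbedding_perm (tY : TopologicalSpace Y) [DiscreteTopology Y] :
    Topology.IsClosedEmbedding
      fun g : Equiv.Perm Y => ((g : Y → Y), ((g⁻¹ : Equiv.Perm Y) : Y → Y)) := by
  have hcont : Continuous
      fun g : Equiv.Perm Y => ((g : Y → Y), ((g⁻¹ : Equiv.Perm Y) : Y → Y)) :=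
    (continuous_perm_coe tY).prodMk ((continuous_perm_coe tY).comp continuous_inv)
  have hind : Topology.IsInducing fun g : Equiv.Perm Y => (g : Y → Y) := by
    refine ⟨?_⟩
    obtain rfl : tY = ⊥ := DiscreteTopology.eq_bot
    rfl
  refine ⟨⟨Topology.IsInducing.of_comp hcont continuous_fst hind, fun g h hgh => ?_⟩, ?_⟩
  · exact Equiv.coe_fn_injective (congrArg Prod.fst hgh)
  · have hrange : Set.range
        (fun g : Equiv.Perm Y => ((g : Y → Y), ((g⁻¹ : Equiv.Perm Y) : Y → Y))) =
        ⋂ y : Y, {p : (Y → Y) × (Y → Y) | p.2 (p.1 y) = y} ∩ {p | p.1 (p.2 y) = y} := by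
      ext ⟨p, q⟩
      simp only [Set.mem_range, Prod.mk.injEq, Set.mem_iInter, Set.mem_inter_iff,
        Set.mem_ofPred_eq]
      constructor
      · rintro ⟨g, rfl, rfl⟩ y
        simp
      · intro h
        exact ⟨⟨p, q, fun y => (h y).1, fun y => (h y).2⟩, rfl, rfl⟩
    rw [hrange]
    refine isClosed_iInter fun y => ?_
    have heval : ∀ (A B : (Y → Y) × (Y → Y) → (Y → Y)), Continuous A → Continuous B →
        IsClosed {p | A p (B p y) = y} := by
      intro A B hA hB
      -- Quantifying over the possible values of `B p y` leaves only evaluations at fixed points,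
      -- which are continuous.
      have hcl : {p | A p (B p y) = y} =
          ⋂ z : Y, {p | B p y = z}ᶜ ∪ {p | A p z = y} := by
        ext p
        simp only [Set.mem_iInter]
        refine ⟨fun h z => ?_, fun h => (h (B p y)).resolve_left (not_not.2 rfl)⟩
        by_cases hz : B p y = z
        · exact .inr (hz ▸ h)
        · exact .inl hz
      rw [hcl]
      refine isClosed_iInter fun z => IsClosed.union ?_ ?_
      · exact (((isOpen_discrete {z}).preimage ((continuous_apply y).comp hB))).isClosed_compl
      · exact (isClosed_discrete {y}).preimage ((continuous_apply z).comp hA)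
    exact (heval _ _ continuous_snd continuous_fst).inter
      (heval _ _ continuous_fst continuous_snd)

/-- A closed subgroup is compact for the permutation topology if and only if its orbits are
finite. -/
theorem isCompact_subgroup_iff {G : Type v} [Group G] [TopologicalSpace G]
    (ι : G →* Equiv.Perm Y) (hι : Topology.IsClosedEmbedding ι) (H : Subgroup G)
    (hH : IsClosed (H : Set G)) :
    IsCompact (H : Set G) ↔ ∀ y, {z | ∃ h ∈ H, ι h y = z}.Finite := by
  let tY : TopologicalSpace Y := ⊥
  have hd : DiscreteTopology Y := ⟨rfl⟩
  constructor
  · intro hK y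
    have h := hK.image ((continuous_perm_apply tY y).comp hι.continuous)
    exact h.finite_of_discrete
  · intro hfin
    -- Both `h` and `h⁻¹` map each point into its finite orbit, so `H` lies in the preimage of a
    -- compact product under a closed embedding.
    have hemb := (isClosedEmbedding_perm tY).comp hι
    have hpi : IsCompact (Set.univ.pi fun y => {z | ∃ h ∈ H, ι h y = z}) :=
      isCompact_univ_pi fun y => (hfin y).isCompact
    refine (hemb.isCompact_preimage (hpi.prod hpi)).of_isClosed_subset hH fun h hh => ?_
    refine ⟨fun y _ => ⟨h, hh, rfl⟩, fun y _ => ⟨h⁻¹, H.inv_mem hh, ?_⟩⟩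
    simp

end PermutationTopology

/-! ### Topology and orbits of the universal group. -/

namespace ChamberSystem

variable {I : Type u} {C : Type v} {X : I → Type w} {Δ : ChamberSystem I C} {M : CoxeterMatrix I}

theorem isClosed_aut (Δ : ChamberSystem I C) : IsClosed (Δ.Aut : Set (Equiv.Perm C)) := by
  let tC : TopologicalSpace C := ⊥
  have hd : DiscreteTopology C := ⟨rfl⟩
  have h : (Δ.Aut : Set (Equiv.Perm C)) =
      ⋂ (i : I) (c : C) (d : C), (fun g : Equiv.Perm C => (g c, g d)) ⁻¹'
        {p | (Δ.adj i) p.1 p.2 ↔ (Δ.adj i) c d} := by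
    ext g
    simp only [Set.mem_iInter]
    rfl
  rw [h]
  exact isClosed_iInter fun i => isClosed_iInter fun c => isClosed_iInter fun d =>
    (isClosed_discrete _).preimage
      ((continuous_perm_apply tC c).prodMk (continuous_perm_apply tC d))

/-- The value of the local action at one colour depends only on the image of one chamber. -/
theorem LegalColouring.continuous_localAction (lam : Δ.LegalColouring X) (i : I) (c : C) :
    Continuous fun g : Δ.Aut => lam.localAction g i c := by
  let tC : TopologicalSpace C := ⊥
  have hd : DiscreteTopology C := ⟨rfl⟩
  let tX : TopologicalSpace (X i) := ⊥
  have hdX : DiscreteTopology (X i) := ⟨rfl⟩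
  refine continuous_induced_rng.2 (continuous_pi fun x => ?_)
  obtain ⟨⟨d, hd⟩, rfl⟩ := (lam.bijective i c).2 x
  have h : (fun g : Δ.Aut => lam.localAction g i c (lam.colour d i)) =
      (fun e : C => lam.colour e i) ∘ (fun g : Equiv.Perm C => g d) ∘ Subtype.val :=
    funext fun g => lam.localAction_colour g i c d hd
  change Continuous fun g : Δ.Aut => lam.localAction g i c (lam.colour d i)
  rw [h]
  exact continuous_of_discreteTopology.comp
    ((continuous_perm_apply tC d).comp continuous_subtype_val)

theorem isClosed_universalGroup (lam : Δ.LegalColouring X)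
    (F : (i : I) → Subgroup (Equiv.Perm (X i)))
    (hF : ∀ i, IsClosed (F i : Set (Equiv.Perm (X i)))) :
    IsClosed (universalGroup lam F : Set Δ.Aut) := by
  have h : (universalGroup lam F : Set Δ.Aut) =
      ⋂ (i : I) (c : C), (fun g : Δ.Aut => lam.localAction g i c) ⁻¹' (F i) := by
    ext g
    simp only [Set.mem_iInter]
    rfl
  rw [h]
  exact isClosed_iInter fun i => isClosed_iInter fun c =>
    (hF i).preimage (lam.continuous_localAction i c)

theorem isClosedEmbedding_universalGroup (lam : Δ.LegalColouring X)
    (F : (i : I) → Subgroup (Equiv.Perm (X i)))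
    (hF : ∀ i, IsClosed (F i : Set (Equiv.Perm (X i)))) :
    Topology.IsClosedEmbedding (Δ.Aut.subtype.comp (universalGroup lam F).subtype) :=
  (isClosed_aut Δ).isClosedEmbedding_subtypeVal.comp
    (isClosed_universalGroup lam F hF).isClosedEmbedding_subtypeVal

theorem isClosed_of_fixed {Y : Type u} {G : Type v} [Group G] [TopologicalSpace G]
    (ι : G →* Equiv.Perm Y) (hι : Continuous ι) (y : Y) : IsClosed {g | ι g y = y} := by
  let tY : TopologicalSpace Y := ⊥
  have hd : DiscreteTopology Y := ⟨rfl⟩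
  exact (isClosed_discrete {y}).preimage ((continuous_perm_apply tY y).comp hι)

theorem isOpen_of_fixed {Y : Type u} {G : Type v} [Group G] [TopologicalSpace G]
    (ι : G →* Equiv.Perm Y) (hι : Continuous ι) (y : Y) : IsOpen {g | ι g y = y} := by
  let tY : TopologicalSpace Y := ⊥
  have hd : DiscreteTopology Y := ⟨rfl⟩
  exact (isOpen_discrete {y}).preimage ((continuous_perm_apply tY y).comp hι)

theorem isCompact_stabilizer_local_iff (F : (i : I) → Subgroup (Equiv.Perm (X i)))
    (hF : ∀ i, IsClosed (F i : Set (Equiv.Perm (X i)))) (i : I) (x : X i) :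
    IsCompact (MulAction.stabilizer (F i) x : Set (F i)) ↔
      ∀ z, {t | ∃ f ∈ F i, f x = x ∧ f z = t}.Finite := by
  have hcl : IsClosed (MulAction.stabilizer (F i) x : Set (F i)) :=
    isClosed_of_fixed (F i).subtype continuous_subtype_val x
  rw [isCompact_subgroup_iff (F i).subtype (hF i).isClosedEmbedding_subtypeVal _ hcl]
  refine forall_congr' fun z => iff_of_eq (congrArg Set.Finite (Set.ext fun t => ?_))
  constructor
  · rintro ⟨f, hf, h⟩
    exact ⟨f.1, f.2, hf, h⟩
  · rintro ⟨f, hfF, hf, h⟩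
    exact ⟨⟨f, hfF⟩, hf, h⟩

theorem isCompact_stabilizer_universalGroup_iff (lam : Δ.LegalColouring X)
    (F : (i : I) → Subgroup (Equiv.Perm (X i)))
    (hF : ∀ i, IsClosed (F i : Set (Equiv.Perm (X i)))) (c : C) :
    IsCompact (MulAction.stabilizer (universalGroup lam F) c : Set (universalGroup lam F)) ↔
      ∀ d, {e | ∃ g ∈ universalGroup lam F, g.1 c = c ∧ g.1 d = e}.Finite := by
  have hemb := isClosedEmbedding_universalGroup lam F hF
  have hcl : IsClosed (MulAction.stabilizer (universalGroup lam F) c :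
      Set (universalGroup lam F)) := isClosed_of_fixed _ hemb.continuous c
  rw [isCompact_subgroup_iff _ hemb _ hcl]
  refine forall_congr' fun z => iff_of_eq (congrArg Set.Finite (Set.ext fun t => ?_))
  constructor
  · rintro ⟨g, hg, h⟩
    exact ⟨g.1, g.2, hg, h⟩
  · rintro ⟨g, hgU, hg, h⟩
    exact ⟨⟨g, hgU⟩, hg, h⟩

/-- If `U(F)` is locally compact, the pointwise stabiliser of some finite set of chambers has
finite orbits. -/
theorem exists_finite_orbits_of_locallyCompact (lam : Δ.LegalColouring X)
    (F : (i : I) → Subgroup (Equiv.Perm (X i)))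
    (hF : ∀ i, IsClosed (F i : Set (Equiv.Perm (X i))))
    (h : LocallyCompactSpace (universalGroup lam F)) :
    ∃ S : Set C, S.Finite ∧
      ∀ d, {e | ∃ g ∈ universalGroup lam F, (∀ s ∈ S, g.1 s = s) ∧ g.1 d = e}.Finite := by
  have hemb := isClosedEmbedding_universalGroup lam F hF
  obtain ⟨K, hK, hK1⟩ := exists_compact_mem_nhds (1 : universalGroup lam F)
  have hb := (permTopology_hasBasis_nhds (1 : Equiv.Perm C)).comap
    (Δ.Aut.subtype.comp (universalGroup lam F).subtype)
  have hnhds : nhds (1 : universalGroup lam F) =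
      Filter.comap (Δ.Aut.subtype.comp (universalGroup lam F).subtype)
        (nhds (1 : Equiv.Perm C)) := hemb.isInducing.nhds_eq_comap 1
  rw [hnhds, hb.mem_iff] at hK1
  obtain ⟨S, hS, hSK⟩ := hK1
  refine ⟨S, hS, fun d => ?_⟩
  let tC : TopologicalSpace C := ⊥
  have hd : DiscreteTopology C := ⟨rfl⟩
  have hfin := (hK.image ((continuous_perm_apply tC d).comp hemb.continuous)).finite_of_discrete
  refine hfin.subset ?_
  rintro e ⟨g, hgU, hgS, rfl⟩
  exact ⟨⟨g, hgU⟩, hSK hgS, rfl⟩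

theorem locallyCompact_of_isCompact_stabilizer (lam : Δ.LegalColouring X)
    (F : (i : I) → Subgroup (Equiv.Perm (X i))) (c : C)
    (h : IsCompact (MulAction.stabilizer (universalGroup lam F) c :
      Set (universalGroup lam F))) :
    LocallyCompactSpace (universalGroup lam F) := by
  have hopen : IsOpen (MulAction.stabilizer (universalGroup lam F) c :
      Set (universalGroup lam F)) :=
    isOpen_of_fixed (Δ.Aut.subtype.comp (universalGroup lam F).subtype)
      (continuous_subtype_val.comp continuous_subtype_val) c
  exact h.locallyCompactSpace_of_mem_nhds_of_group (hopen.mem_nhds (Subgroup.one_mem _))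

/-- Finite suborbits of the local groups give finite suborbits of the universal group. -/
theorem finite_orbits_universalGroup (hΔ : Δ.IsBuilding M) (lam : Δ.LegalColouring X)
    (F : (i : I) → Subgroup (Equiv.Perm (X i)))
    (hfin : ∀ (i : I) (x z : X i), {t | ∃ f ∈ F i, f x = x ∧ f z = t}.Finite) (c d : C) :
    {e | ∃ g ∈ universalGroup lam F, g.1 c = c ∧ g.1 d = e}.Finite := by
  refine hΔ.induction_on
    (p := fun d => {e | ∃ g ∈ universalGroup lam F, g.1 c = c ∧ g.1 d = e}.Finite) c ?_ ?_ d
  · refine (Set.finite_singleton c).subset ?_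
    rintro e ⟨g, -, hg, rfl⟩
    exact hg
  · intro i d e hde hd
    have horb : ∀ d₁, d₁ ∈ {e | ∃ g ∈ universalGroup lam F, g.1 c = c ∧ g.1 d = e} →
        {e₁ | ∃ g ∈ universalGroup lam F, g.1 c = c ∧ g.1 d = d₁ ∧ g.1 e = e₁}.Finite := by
      rintro d₁ ⟨g₁, hg₁, -, hd₁⟩
      -- Take `g₁` as reference. For any other `g` with `g d = d₁`, the quotient of the local
      -- actions at `d` lies in `F i` and fixes the colour of `d`; its finitely many values at the
      -- colour of `e` determine `g e`.
      refine ((hfin i (lam.colour d i) (lam.colour e i)).image fun t =>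
        lam.move i (lam.localAction g₁ i d t) d₁).subset ?_
      rintro e₁ ⟨g, hg, -, hgd, rfl⟩
      have hlocd : lam.localAction g₁ i d (lam.colour d i) = lam.colour d₁ i := by
        rw [lam.localAction_colour g₁ i d d ((Δ.adj i).refl d), hd₁]
      refine ⟨((lam.localAction g₁ i d)⁻¹ * lam.localAction g i d) (lam.colour e i),
        ⟨_, (F i).mul_mem ((F i).inv_mem (hg₁ i d)) (hg i d), ?_, rfl⟩, ?_⟩
      · rw [Equiv.Perm.mul_apply, lam.localAction_colour g i d d ((Δ.adj i).refl d), hgd,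
          ← hlocd]
        exact (lam.localAction g₁ i d).symm_apply_apply _
      · dsimp only
        rw [Equiv.Perm.mul_apply, Equiv.Perm.coe_inv, Equiv.apply_symm_apply,
          lam.localAction_colour g i d e hde]
        refine (lam.eq_move ?_ rfl).symm
        rw [← hgd]
        exact (g.2 i d e).2 hde
    refine (hd.biUnion horb).subset ?_
    rintro e₁ ⟨g, hg, hgc, rfl⟩
    exact Set.mem_biUnion (x := g.1 d) ⟨g, hg, hgc, rfl⟩ ⟨g, hg, hgc, rfl, rfl⟩

/-- Finite suborbits of the universal group give finite suborbits of the local groups. -/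
theorem finite_orbits_local (lam : Δ.LegalColouring X)
    (F : (i : I) → Subgroup (Equiv.Perm (X i))) {i : I} {x : X i} (P : Δ.Aut → Prop)
    (c : C) (hP : ∀ d, {e | ∃ g ∈ universalGroup lam F, P g ∧ g.1 d = e}.Finite)
    (hc : ∀ f ∈ F i, f x = x → ∃ g ∈ universalGroup lam F, P g ∧
      ∀ d ∈ Δ.panel i c, lam.colour (g.1 d) i = f (lam.colour d i)) (z : X i) :
    {t | ∃ f ∈ F i, f x = x ∧ f z = t}.Finite := by
  -- The orbit of `z` is covered by the `i`-colours of the finite orbit of the chamber coloured `z`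
  -- in the panel of `c`.
  refine ((hP (lam.move i z c)).image fun e => lam.colour e i).subset ?_
  rintro t ⟨f, hfF, hf, rfl⟩
  obtain ⟨g, hgU, hgP, hg⟩ := hc f hfF hf
  refine ⟨_, ⟨g, hgU, hgP, rfl⟩, ?_⟩
  dsimp only
  rw [hg _ (lam.adj_move i z c), lam.colour_move]

end ChamberSystem

theorem mainTheorem8 {I : Type u} [Finite I] {C : Type v} {X : I → Type w}
    (M : CoxeterMatrix I) (hM : M.IsRightAngled)
    (Δ : ChamberSystem I C) (hΔ : Δ.IsBuilding M) (hq : Δ.IsSemiregular X)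
    (lam : Δ.LegalColouring X) (F : (i : I) → Subgroup (Equiv.Perm (X i)))
    (hF : ∀ i, IsClosed (F i : Set (Equiv.Perm (X i)))) :
    (M.NoIsolatedNodes →
      List.TFAE [
        ∀ (i : I) (x : X i), IsCompact (MulAction.stabilizer (F i) x : Set (F i)),
        ∀ c : C, IsCompact (MulAction.stabilizer (ChamberSystem.universalGroup lam F) c :
          Set (ChamberSystem.universalGroup lam F)),
        LocallyCompactSpace (ChamberSystem.universalGroup lam F)]) ∧
    ((∀ (i : I) (x : X i), IsCompact (MulAction.stabilizer (F i) x : Set (F i))) ↔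
      ∀ c : C, IsCompact (MulAction.stabilizer (ChamberSystem.universalGroup lam F) c :
        Set (ChamberSystem.universalGroup lam F))) ∧
    ((∀ c : C, IsCompact (MulAction.stabilizer (ChamberSystem.universalGroup lam F) c :
        Set (ChamberSystem.universalGroup lam F))) →
      LocallyCompactSpace (ChamberSystem.universalGroup lam F)) := by
  have hne : Nonempty C := hΔ.1
  have h12 : (∀ (i : I) (x : X i), IsCompact (MulAction.stabilizer (F i) x : Set (F i))) ↔
      ∀ c : C, IsCompact (MulAction.stabilizer (ChamberSystem.universalGroup lam F) c :
        Set (ChamberSystem.universalGroup lam F)) := by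
    simp only [ChamberSystem.isCompact_stabilizer_local_iff F hF,
      ChamberSystem.isCompact_stabilizer_universalGroup_iff lam F hF]
    refine ⟨fun h => ChamberSystem.finite_orbits_universalGroup hΔ lam F h, fun h i x => ?_⟩
    obtain ⟨a⟩ := hne
    have hax := lam.colour_move i x a
    refine ChamberSystem.finite_orbits_local lam F _ (lam.move i x a) (h (lam.move i x a)) ?_
    intro f hfF hf
    -- With `V = ∅`, the twist applies `f` on every `i`-panel; the base chamber is fixed because its
    -- colour is `x`.
    obtain ⟨g, hgU, hga, -, hg⟩ :=
      ChamberSystem.LegalColouring.exists_universalGroup_of_perm hM hΔ lam F hfF hf ∅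
        (fun _ _ _ _ _ h => h) (fun _ _ _ h => h.elim) _ (.inr hax)
    exact ⟨g, hgU, hga, fun d _ => by simpa using hg d⟩
  have h23 : (∀ c : C, IsCompact (MulAction.stabilizer (ChamberSystem.universalGroup lam F) c :
        Set (ChamberSystem.universalGroup lam F))) →
      LocallyCompactSpace (ChamberSystem.universalGroup lam F) := fun h =>
    ChamberSystem.locallyCompact_of_isCompact_stabilizer lam F hne.some (h _)
  refine ⟨fun hiso => ?_, h12, h23⟩
  tfae_have 1 ↔ 2 := h12
  tfae_have 2 → 3 := h23
  tfae_have 3 → 1 := by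
    intro hlc i x
    rw [ChamberSystem.isCompact_stabilizer_local_iff F hF]
    obtain ⟨j, hji, hij⟩ := hiso i
    obtain ⟨S, hS, hfin⟩ := ChamberSystem.exists_finite_orbits_of_locallyCompact lam F hF hlc
    obtain ⟨c, hc⟩ := ChamberSystem.LegalColouring.exists_local_action_of_finite hM hΔ hq lam F
      ((hM i j hji.symm).resolve_left hij) x S hS
    refine ChamberSystem.finite_orbits_local lam F _ c hfin ?_
    intro f hfF hf
    obtain ⟨g, hgU, hgS, hg⟩ := hc f hfF hf
    exact ⟨g, hgU, hgS, hg⟩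
  tfae_finish
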